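/- Label the vertices of the regular dodecahedron $\mathcal{P}$ by $1,\dots,20$ so that its twelve faces are $\{1,2,3,4,5\}$, $\{1,2,6,7,19\}$, $\{2,3,7,8,20\}$, $\{3,4,8,9,16\}$, $\{4,5,9,10,17\}$, $\{1,5,6,10,18\}$, $\{11,12,13,14,15\}$, $\{9,11,12,16,17\}$, $\{10,12,13,17,18\}$, $\{6,13,14,18,19\}$, $\{7,14,15,19,20\}$, $\{8,11,15,16,20\}$, and let $F=\sum_{f}\prod_{v\in f}x_v\in\mathbb{R}[x_1,\dots,x_{20}]$, the sum over these faces $f$. Let $\mathbb{R}[\partial_1,\dots,\partial_{20}]$ act on $\mathbb{R}[x_1,\dots,x_{20}]$ by $\partial_i=\partial/\partial x_i$, put $\operatorname{Ann}(F)=\{g : gF=0\}$ and $A=\mathbb{R}[\partial_1,\dots,\partial_{20}]/\operatorname{Ann}(F)$, and let $A_k\subset A$ be the space of classes of homogeneous polynomials of degree $k$. For $a\in\mathbb{R}^{20}$ put $\ell_a=\sum_i a_i\partial_i\in A_1$. Then: 1. $A=\bigoplus_k A_k$ is graded with socle degree $5$ (that is, $A_5\neq 0$ and $A_k=0$ for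 $k>5$), and its Hilbert series $(\dim A_0,\dots,\dim A_5)$ is $(1,20,90,90,20,1)$. 2. $A$ has the strong Lefschetz property: there is $\ell\in A_1$ such that $\times\ell^{5-2k}\colon A_k\to A_{5-k}$ is bijective for all integers $0\le k\le 5/2$. Such an $\ell$ is $\ell_c$ with $c_1=0$ and $c_i=1$ for $i\ne1$. 3. Let $b_i=0$ for $i\in\{6,7,8,9,10\}$ and $b_i=1$ otherwise. The Hessian matrix $\left(\partial_i\partial_jF\right)_{i,j}$ evaluated at $b$ is non-degenerate and has more than two positive eigenvalues (counted with multiplicity). The algebra $A$ does not satisfy the Hodge--Riemann relation with respect to $\ell_b=\sum_{i\notin\{6,\dots,10\}}\partial_i$; that is, it is not true that for every integer $0\le k\le 5/2$ the symmetric bilinear form $(f,g)\mapsto(-1)^k\, f\,\ell_b^{5-2k} g\,F\in\mathbb{R}$ on $A_k$ is positive definite on the kernel of $\times\ell_b^{5-2k+1}\colon A_k\to A_{5-k+1}$. -/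

import Mathlib

noncomputable section

namespace PolyhedralAlgebra

open MvPolynomial

variable {σ : Type*}

section Apolarity

theorem pderiv_comm_apply (i j : σ) (F : MvPolynomial σ ℝ) :
    pderiv i (pderiv j F) = pderiv j (pderiv i F) := by
  classical
  have h : ⁅(pderiv i : Derivation ℝ (MvPolynomial σ ℝ) (MvPolynomial σ ℝ)),
      (pderiv j : Derivation ℝ (MvPolynomial σ ℝ) (MvPolynomial σ ℝ))⁆ = 0 := by
    apply MvPolynomial.derivation_ext
    intro k
    simp only [Derivation.commutator_apply, pderiv_X, Pi.single_apply, Derivation.zero_apply]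
    split_ifs <;> simp
  have h2 := congrArg
    (fun D : Derivation ℝ (MvPolynomial σ ℝ) (MvPolynomial σ ℝ) => D F) h
  simp only [Derivation.commutator_apply, Derivation.zero_apply] at h2
  exact sub_eq_zero.mp h2

/-- The set of the operators `∂ᵢ = ∂/∂xᵢ` on `ℝ[x]`. -/
def partials (σ : Type*) : Set (Module.End ℝ (MvPolynomial σ ℝ)) :=
  Set.range fun i : σ => (pderiv i).toLinearMap

theorem partials_comm : ∀ a ∈ partials σ, ∀ b ∈ partials σ, a * b = b * a := by
  rintro _ ⟨i, rfl⟩ _ ⟨j, rfl⟩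
  refine LinearMap.ext fun F => ?_
  exact pderiv_comm_apply i j F

open scoped IsMulCommutative in
/-- The action of `ℝ[∂]` on `ℝ[x]` by differential operators with constant coefficients:
the algebra homomorphism which sends the variable `X i` of the first polynomial ring to the
operator `∂/∂xᵢ`. -/
def diffOp : MvPolynomial σ ℝ →ₐ[ℝ] Module.End ℝ (MvPolynomial σ ℝ) :=
  haveI := Algebra.isMulCommutative_adjoin ℝ (partials_comm (σ := σ))
  (Algebra.adjoin ℝ (partials σ)).val.comp
    (aeval fun i : σ =>
      (⟨(pderiv i).toLinearMap, Algebra.subset_adjoin ⟨i, rfl⟩⟩ : Algebra.adjoin ℝ (partials σ)))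

@[simp] theorem diffOp_X (i : σ) (F : MvPolynomial σ ℝ) : diffOp (X i) F = pderiv i F := by
  simp [diffOp]

/-- `Ann(F) = {f ∈ ℝ[∂] | f F = 0}`. -/
def Ann (F : MvPolynomial σ ℝ) : Ideal (MvPolynomial σ ℝ) where
  carrier := {f | diffOp f F = 0}
  add_mem' {f g} hf hg := by
    simp only [Set.mem_ofPred_eq] at hf hg ⊢
    rw [map_add, LinearMap.add_apply, hf, hg, add_zero]
  zero_mem' := by simp
  smul_mem' g f hf := by
    simp only [Set.mem_ofPred_eq] at hf ⊢
    rw [smul_eq_mul, map_mul, Module.End.mul_apply, hf, map_zero]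

theorem mem_Ann {F f : MvPolynomial σ ℝ} : f ∈ Ann F ↔ diffOp f F = 0 := Iff.rfl

/-- `A = ℝ[∂] / Ann(F)`. -/
abbrev Alg (F : MvPolynomial σ ℝ) : Type _ := MvPolynomial σ ℝ ⧸ Ann F

/-- `A_k`: the classes of the homogeneous polynomials of degree `k` in `ℝ[∂]`. -/
def gradedPiece (F : MvPolynomial σ ℝ) (k : ℕ) : Submodule ℝ (Alg F) :=
  (homogeneousSubmodule σ ℝ k).map (Ideal.Quotient.mkₐ ℝ (Ann F)).toLinearMap

/-- The map `A → ℝ[x]`, `f ↦ f F`. -/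
def actOn (F : MvPolynomial σ ℝ) : Alg F →ₗ[ℝ] MvPolynomial σ ℝ :=
  (((Ann F).restrictScalars ℝ).liftQ (diffOp.toLinearMap.flip F) fun _ hf => hf) ∘ₗ
    (Submodule.Quotient.restrictScalarsEquiv ℝ (Ann F)).symm.toLinearMap

@[simp] theorem actOn_mk (F f : MvPolynomial σ ℝ) :
    actOn F (Ideal.Quotient.mk (Ann F) f) = diffOp f F := rfl

/-- The Poincaré duality `(f, g) ↦ f g F`. For `F` homogeneous of degree `s`, `f ∈ A_k` and
`g ∈ A_{s-k}` the polynomial `f g F` is a constant, so that taking its constant coefficient only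
identifies constant polynomials with real numbers. -/
def poincare (F : MvPolynomial σ ℝ) (f g : Alg F) : ℝ := constantCoeff (actOn F (f * g))

/-- The element `ℓ_a = ∑ aᵢ ∂ᵢ` of `A_1`. -/
def linearForm [Fintype σ] (F : MvPolynomial σ ℝ) (a : σ → ℝ) : gradedPiece F 1 :=
  ⟨Ideal.Quotient.mk (Ann F) (∑ i, C (a i) * X i),
    Submodule.mem_map_of_mem (f := (Ideal.Quotient.mkₐ ℝ (Ann F)).toLinearMap)
      ((homogeneousSubmodule σ ℝ 1).sum_mem fun i _ => by
        simpa using (isHomogeneous_C σ (a i)).mul (isHomogeneous_X ℝ i))⟩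

/-- The Hessian matrix `(∂ᵢ ∂ⱼ F)` evaluated at the point `a`. -/
def hessian (F : MvPolynomial σ ℝ) (a : σ → ℝ) : Matrix σ σ ℝ :=
  Matrix.of fun i j => eval a (pderiv i (pderiv j F))

theorem hessian_isHermitian (F : MvPolynomial σ ℝ) (a : σ → ℝ) : (hessian F a).IsHermitian := by
  ext i j
  simp [hessian, pderiv_comm_apply i j]

end Apolarity

section Lefschetz

variable {A : Type*} [CommRing A] [Algebra ℝ A]

/-- For a graded algebra `A = ⨁_{k ≤ s} A_k`, an element `ℓ ∈ A_1` is a strong Lefschetz element if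
`×ℓ^{s-2k} : A_k → A_{s-k}` is bijective for every `k ≤ s/2`. -/
def IsStrongLefschetzElement (𝒜 : ℕ → Submodule ℝ A) (s : ℕ) (ℓ : 𝒜 1) : Prop :=
  ∀ k : ℕ, 2 * k ≤ s →
    Set.BijOn (fun f : A => (ℓ : A) ^ (s - 2 * k) * f) (𝒜 k) (𝒜 (s - k))

/-- The strong Lefschetz property. -/
def HasStrongLefschetzProperty (𝒜 : ℕ → Submodule ℝ A) (s : ℕ) : Prop :=
  ∃ ℓ : 𝒜 1, IsStrongLefschetzElement 𝒜 s ℓ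

/-- The Hodge–Riemann relation with respect to `ℓ ∈ A_1`, for the pairings `P : A_k × A_{s-k} → ℝ`:
for every `k ≤ s/2` the form `(f, g) ↦ (-1)^k P(f, ℓ^{s-2k} g)` on `A_k` is positive definite on the
kernel of `×ℓ^{s-2k+1} : A_k → A_{s-k+1}`. -/
def SatisfiesHodgeRiemann (𝒜 : ℕ → Submodule ℝ A) (s : ℕ) (P : A → A → ℝ) (ℓ : 𝒜 1) : Prop :=
  ∀ k : ℕ, 2 * k ≤ s → ∀ f ∈ 𝒜 k, (ℓ : A) ^ (s - 2 * k + 1) * f = 0 → f ≠ 0 →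
    0 < (-1) ^ k * P f ((ℓ : A) ^ (s - 2 * k) * f)

end Lefschetz

section Polyhedra

/-- `F_P = ∑_F ∏_{v ∈ F} x_v`, the sum over the faces `F` of a polyhedron, each face being given by
its set of vertices. -/
def facePolynomial (faces : Finset (Finset σ)) : MvPolynomial σ ℝ :=
  ∑ f ∈ faces, ∏ v ∈ f, X v

/-- The faces of the regular dodecahedron with vertices labelled `1, …, 20`. The labels are taken in
`Fin 20`, where the numeral `20` is the element `0`. -/
def dodecahedronFaces : Finset (Finset (Fin 20)) :=
  {{1, 2, 3, 4, 5}, {1, 2, 6, 7, 19}, {2, 3, 7, 8, 20}, {3, 4, 8, 9, 16},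
   {4, 5, 9, 10, 17}, {1, 5, 6, 10, 18}, {11, 12, 13, 14, 15},
   {11, 12, 16, 17, 9}, {12, 13, 17, 18, 10}, {13, 14, 18, 19, 6},
   {14, 15, 19, 20, 7}, {11, 15, 16, 20, 8}}

/-- The polynomial of the regular dodecahedron. -/
def dodecahedronPolynomial : MvPolynomial (Fin 20) ℝ := facePolynomial dodecahedronFaces

/-- `bᵢ = 0` for `i ∈ {6, 7, 8, 9, 10}` and `bᵢ = 1` otherwise. -/
def pointB : Fin 20 → ℝ := fun i => if i ∈ ({6, 7, 8, 9, 10} : Finset (Fin 20)) then 0 else 1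

/-- `c₁ = 0` and `cᵢ = 1` for `i ≠ 1`. -/
def pointC : Fin 20 → ℝ := fun i => if i = 1 then 0 else 1

end Polyhedra

end PolyhedralAlgebra

end

noncomputable section

namespace PolyhedralAlgebra

open MvPolynomial

set_option linter.unusedSectionVars false

/-! ### Differential operators acting on forms. -/

section Homogeneous

variable {σ : Type*}

/-! The map `f ↦ f F` embeds `A` in the polynomial ring and sends `A_k` to forms of degree `5 - k`.
This gives the grading, and with Euler's identity it makes the pairing `A_k × A_{5-k} → ℝ`
nondegenerate, so `dim A_k = dim A_{5-k}`.

For `G` of degree `n`, iterating Euler's identity gives `ℓ_a ^ n G = n! G(a)`. If `f ∈ A_k` is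
killed by `ℓ_a ^ (5 - 2k)`, it follows that `(g f F)(a) = 0` for all `g` of degree `k`. Lefschetz
injectivity is thus nondegeneracy at `a` of the `k`-th Hessian form `(g, f) ↦ (g f F)(a)`, and
equality of dimensions gives bijectivity (`isStrongLefschetzElement_linearForm`).

Since `F` is a sum of squarefree monomials, `A_k` is spanned by squarefree monomials supported in a
face: for `k = 0, 1, 2` there are 1, 20 and 90 = 60 diagonals + 30 edges. An invertible Hessian
matrix in these monomials yields their linear independence, hence the Hilbert series, as well as the
Lefschetz property. Its entries at a 0/1 point count faces; it is invertible at `c` because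
elimination modulo 5 finds a pivot in every column (`det_ne_zero_of_elimCheck`).

At `b` the Hessian form is `2 ∑ x_k²` on a three-dimensional space, which forces three positive
eigenvalues. In degree one, the Hodge–Riemann relation would make the Hessian negative definite on
the vectors orthogonal to `b`; a difference of two vectors of that space is such a vector and has
positive square. -/

theorem diffOp_C (r : ℝ) (G : MvPolynomial σ ℝ) : diffOp (C r) G = r • G := by
  rw [← algebraMap_eq, AlgHom.commutes, Module.algebraMap_end_apply]

theorem diffOp_mul (f g G : MvPolynomial σ ℝ) : diffOp (f * g) G = diffOp f (diffOp g G) := by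
  rw [map_mul, Module.End.mul_apply]

theorem diffOp_sum {ι : Type*} (t : Finset ι) (f : ι → MvPolynomial σ ℝ) (G : MvPolynomial σ ℝ) :
    diffOp (∑ i ∈ t, f i) G = ∑ i ∈ t, diffOp (f i) G := by
  rw [map_sum, LinearMap.sum_apply]

theorem diffOp_monomial (d : σ →₀ ℕ) (r : ℝ) (G : MvPolynomial σ ℝ) :
    diffOp (monomial d r) G = r • diffOp (monomial d 1) G := by
  rw [← mul_one r, ← C_mul_monomial, diffOp_mul, diffOp_C, mul_one]

theorem diffOp_eq_sum (f G : MvPolynomial σ ℝ) :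
    diffOp f G = ∑ d ∈ f.support, coeff d f • diffOp (monomial d 1) G := by
  conv_lhs => rw [f.as_sum, diffOp_sum]
  exact Finset.sum_congr rfl fun d _ => diffOp_monomial d _ G

theorem diffOp_monomial_isHomogeneous (d : σ →₀ ℕ) :
    ∀ {n : ℕ} {G : MvPolynomial σ ℝ}, G.IsHomogeneous n →
      (diffOp (monomial d 1) G).IsHomogeneous (n - d.degree) ∧
        (n < d.degree → diffOp (monomial d 1) G = 0) := by
  classical
  induction d using Finsupp.induction_linear with
  | zero =>
    intro n G hG
    have h1 : (monomial 0 1 : MvPolynomial σ ℝ) = 1 := rfl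
    simpa [h1] using hG
  | add d e hd he =>
    intro n G hG
    have h1 : (monomial (d + e) 1 : MvPolynomial σ ℝ) = monomial d 1 * monomial e 1 := by
      rw [monomial_mul, one_mul]
    rw [h1, diffOp_mul, map_add]
    obtain ⟨h2, h3⟩ := he hG
    obtain ⟨h4, h5⟩ := hd h2
    refine ⟨by rwa [Nat.sub_sub, add_comm] at h4, fun h => ?_⟩
    by_cases h6 : n < e.degree
    · rw [h3 h6, map_zero]
    · exact h5 (by omega)
  | single i m =>
    rw [Finsupp.degree_single]
    induction m with
    | zero =>
      intro n G hG
      simpa using hG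
    | succ m ih =>
      intro n G hG
      have h1 : (monomial (Finsupp.single i (m + 1)) 1 : MvPolynomial σ ℝ) =
          X i * monomial (Finsupp.single i m) 1 := by
        rw [X, monomial_mul, one_mul, ← Finsupp.single_add, add_comm]
      rw [h1, diffOp_mul, diffOp_X]
      obtain ⟨h2, h3⟩ := ih hG
      refine ⟨by simpa [Nat.sub_sub] using h2.pderiv, fun h => ?_⟩
      by_cases h6 : n < m
      · rw [h3 h6, map_zero]
      · rw [show n - m = 0 by omega, ← totalDegree_zero_iff_isHomogeneous,
          totalDegree_eq_zero_iff_eq_C] at h2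
        rw [h2, pderiv_C]

theorem diffOp_isHomogeneous {f G : MvPolynomial σ ℝ} {k n : ℕ} (hf : f.IsHomogeneous k)
    (hG : G.IsHomogeneous n) : (diffOp f G).IsHomogeneous (n - k) := by
  rw [diffOp_eq_sum]
  refine IsHomogeneous.sum _ _ _ fun d hd => ?_
  have h1 := (diffOp_monomial_isHomogeneous d hG).1
  have h2 : d.degree = k := by
    rw [Finsupp.degree_eq_weight_one]; exact hf (mem_support_iff.1 hd)
  rw [h2] at h1
  exact (homogeneousSubmodule σ ℝ (n - k)).smul_mem _ h1

theorem diffOp_eq_zero_of_lt {f G : MvPolynomial σ ℝ} {k n : ℕ} (hf : f.IsHomogeneous k)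
    (hG : G.IsHomogeneous n) (h : n < k) : diffOp f G = 0 := by
  rw [diffOp_eq_sum]
  refine Finset.sum_eq_zero fun d hd => ?_
  have h2 : d.degree = k := by
    rw [Finsupp.degree_eq_weight_one]; exact hf (mem_support_iff.1 hd)
  rw [(diffOp_monomial_isHomogeneous d hG).2 (h2 ▸ h), smul_zero]

theorem eq_C_of_isHomogeneous_zero {G : MvPolynomial σ ℝ} (hG : G.IsHomogeneous 0) :
    G = C (constantCoeff G) := by
  rw [← totalDegree_zero_iff_isHomogeneous, totalDegree_eq_zero_iff_eq_C] at hG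
  exact hG

theorem eval_eq_constantCoeff {G : MvPolynomial σ ℝ} (hG : G.IsHomogeneous 0) (a : σ → ℝ) :
    eval a G = constantCoeff G := by
  conv_lhs => rw [eq_C_of_isHomogeneous_zero hG, eval_C]

end Homogeneous

/-! ### Euler's identity and its iterates. -/

section Finite

variable {σ : Type*} [Fintype σ]

theorem isHomogeneous_linear (a : σ → ℝ) :
    (∑ i, C (a i) * X i : MvPolynomial σ ℝ).IsHomogeneous 1 :=
  IsHomogeneous.sum _ _ _ fun i _ => by
    simpa using (isHomogeneous_C σ (a i)).mul (isHomogeneous_X ℝ i)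

/-- Euler's identity at the point `a`. -/
theorem eval_diffOp_linear {G : MvPolynomial σ ℝ} {n : ℕ} (hG : G.IsHomogeneous n) (a : σ → ℝ) :
    eval a (diffOp (∑ i, C (a i) * X i) G) = n * eval a G := by
  have h := congrArg (eval a) hG.sum_X_mul_pderiv
  rw [diffOp_sum, map_sum]
  simpa [diffOp_mul, diffOp_C, smul_eval] using h

/-- This turns top powers of `ℓ_a` into evaluation at `a`, and so links Lefschetz maps with
Hessians. The left side is the value of a constant polynomial. -/
theorem eval_diffOp_linear_pow {n : ℕ} (a : σ → ℝ) :
    ∀ {G : MvPolynomial σ ℝ}, G.IsHomogeneous n →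
      eval a (diffOp ((∑ i, C (a i) * X i) ^ n) G) = n.factorial * eval a G := by
  induction n with
  | zero => intro G _; simp
  | succ n ih =>
    intro G hG
    have h1 := diffOp_isHomogeneous (isHomogeneous_linear a) hG
    rw [pow_succ, diffOp_mul, ih h1, eval_diffOp_linear hG, Nat.factorial_succ]
    push_cast
    ring

/-- A form is zero if it is killed by all differential operators of its own order. -/
theorem eq_zero_of_forall_diffOp {n : ℕ} :
    ∀ {G : MvPolynomial σ ℝ}, G.IsHomogeneous n →
      (∀ g : MvPolynomial σ ℝ, g.IsHomogeneous n → diffOp g G = 0) → G = 0 := by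
  induction n with
  | zero =>
    intro G _ h
    simpa using h 1 (isHomogeneous_one σ ℝ)
  | succ n ih =>
    intro G hG h
    have h1 : ∀ i, pderiv i G = 0 := fun i => by
      refine ih (by simpa using hG.pderiv (i := i)) fun g hg => ?_
      rw [← diffOp_X, ← diffOp_mul]
      exact h _ (hg.mul (isHomogeneous_X ℝ i))
    have h2 := hG.sum_X_mul_pderiv
    simp only [h1, mul_zero, Finset.sum_const_zero] at h2
    exact (smul_eq_zero.1 h2.symm).resolve_left n.succ_ne_zero

end Finite

/-! ### The grading of `A`. -/

section Graded

variable {σ : Type*} {F : MvPolynomial σ ℝ} {s : ℕ}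

theorem mem_gradedPiece {k : ℕ} {x : Alg F} :
    x ∈ gradedPiece F k ↔
      ∃ f : MvPolynomial σ ℝ, f.IsHomogeneous k ∧ Ideal.Quotient.mk (Ann F) f = x :=
  Iff.rfl

theorem mk_eq_zero_iff {f : MvPolynomial σ ℝ} :
    Ideal.Quotient.mk (Ann F) f = 0 ↔ diffOp f F = 0 := by
  rw [Ideal.Quotient.eq_zero_iff_mem, mem_Ann]

theorem actOn_eq_zero_iff {x : Alg F} : actOn F x = 0 ↔ x = 0 := by
  obtain ⟨f, rfl⟩ := Ideal.Quotient.mk_surjective x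
  rw [actOn_mk, mk_eq_zero_iff]

theorem actOn_isHomogeneous (hF : F.IsHomogeneous s) {k : ℕ} {x : Alg F}
    (hx : x ∈ gradedPiece F k) : (actOn F x).IsHomogeneous (s - k) := by
  obtain ⟨f, hf, rfl⟩ := mem_gradedPiece.1 hx
  exact diffOp_isHomogeneous hf hF

theorem mul_mem_gradedPiece {k l : ℕ} {x y : Alg F} (hx : x ∈ gradedPiece F k)
    (hy : y ∈ gradedPiece F l) : x * y ∈ gradedPiece F (k + l) := by
  obtain ⟨f, hf, rfl⟩ := mem_gradedPiece.1 hx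
  obtain ⟨g, hg, rfl⟩ := mem_gradedPiece.1 hy
  exact mem_gradedPiece.2 ⟨f * g, hf.mul hg, map_mul _ _ _⟩

theorem pow_mem_gradedPiece {x : Alg F} (hx : x ∈ gradedPiece F 1) (n : ℕ) :
    x ^ n ∈ gradedPiece F n := by
  obtain ⟨f, hf, rfl⟩ := mem_gradedPiece.1 hx
  exact mem_gradedPiece.2 ⟨f ^ n, by simpa using hf.pow n, map_pow _ _ _⟩

theorem gradedPiece_eq_bot (hF : F.IsHomogeneous s) {k : ℕ} (hk : s < k) :
    gradedPiece F k = ⊥ := by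
  rw [eq_bot_iff]
  intro x hx
  obtain ⟨f, hf, rfl⟩ := mem_gradedPiece.1 hx
  exact (Submodule.mem_bot ℝ).2 (mk_eq_zero_iff.2 (diffOp_eq_zero_of_lt hf hF hk))

theorem iSup_gradedPiece : ⨆ k, gradedPiece F k = ⊤ := by
  rw [eq_top_iff]
  intro x _
  obtain ⟨f, rfl⟩ := Ideal.Quotient.mk_surjective x
  rw [← sum_homogeneousComponent f, map_sum]
  exact Submodule.sum_mem _ fun k _ => Submodule.mem_iSup_of_mem k
    (mem_gradedPiece.2 ⟨_, homogeneousComponent_isHomogeneous k f, rfl⟩)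

theorem iSupIndep_gradedPiece (hF : F.IsHomogeneous s) : iSupIndep (gradedPiece F) := by
  intro i
  rw [Submodule.disjoint_def]
  intro x hx hx'
  rcases lt_or_ge s i with hi | hi
  · rwa [gradedPiece_eq_bot hF hi, Submodule.mem_bot] at hx
  have h1 : ⨆ j, ⨆ (_ : j ≠ i), gradedPiece F j ≤
      LinearMap.ker ((homogeneousComponent (s - i)).comp (actOn F)) := by
    refine iSup₂_le fun j hj y hy => ?_
    -- Truncated subtraction gives `s - j = 0 = s - s` for `j > s`, so degrees of images separate
    -- the pieces only up to `s`; beyond it the pieces vanish.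
    rcases lt_or_ge s j with hj' | hj'
    · rw [gradedPiece_eq_bot hF hj', Submodule.mem_bot] at hy
      rw [hy]; exact Submodule.zero_mem _
    · rw [LinearMap.mem_ker, LinearMap.comp_apply,
        homogeneousComponent_of_mem (actOn_isHomogeneous hF hy), if_neg (by omega)]
  have h2 := h1 hx'
  rw [LinearMap.mem_ker, LinearMap.comp_apply,
    homogeneousComponent_of_mem (actOn_isHomogeneous hF hx), if_pos rfl] at h2
  exact actOn_eq_zero_iff.1 h2

theorem isInternal_gradedPiece (hF : F.IsHomogeneous s) :
    DirectSum.IsInternal (gradedPiece F) :=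
  (DirectSum.isInternal_submodule_iff_iSupIndep_and_iSup_eq_top _).2
    ⟨iSupIndep_gradedPiece hF, iSup_gradedPiece⟩

instance [Finite σ] (k : ℕ) : FiniteDimensional ℝ (gradedPiece F k) := by
  have : FiniteDimensional ℝ (homogeneousSubmodule σ ℝ k) :=
    Module.Finite.iff_fg.2 (homogeneousSubmodule_fg σ ℝ k)
  unfold gradedPiece
  infer_instance

end Graded

/-! ### Poincaré duality and the Hessian criterion. -/

section Lefschetz

variable {σ : Type*} {F : MvPolynomial σ ℝ} {s : ℕ}

/-- The Poincaré duality as a bilinear map `A_l × A_k → ℝ`. -/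
def poincarePairing (F : MvPolynomial σ ℝ) (k l : ℕ) :
    gradedPiece F l →ₗ[ℝ] Module.Dual ℝ (gradedPiece F k) :=
  ((LinearMap.mul ℝ (Alg F)).compr₂ (lcoeff ℝ 0 ∘ₗ actOn F)).domRestrict₁₂ _ _

/-- For `x ∈ A_{s-k}` the form `x F` has degree `k`; if `x` pairs to zero with `A_k`, every operator
of order `k` kills this form, which is therefore zero. -/
theorem poincarePairing_injective [Fintype σ] (hF : F.IsHomogeneous s) {k : ℕ} (hk : k ≤ s) :
    Function.Injective (poincarePairing F k (s - k)) := by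
  rw [injective_iff_map_eq_zero]
  rintro ⟨x, hx⟩ h
  rw [Subtype.ext_iff]
  refine actOn_eq_zero_iff.1 (eq_zero_of_forall_diffOp (n := k) ?_ fun g hg => ?_)
  · simpa [Nat.sub_sub_self hk] using actOn_isHomogeneous hF hx
  · obtain ⟨f, hf, rfl⟩ := mem_gradedPiece.1 hx
    have h1 := LinearMap.congr_fun h ⟨_, mem_gradedPiece.2 ⟨g, hg, rfl⟩⟩
    change constantCoeff (diffOp (f * g) F) = 0 at h1
    rw [mul_comm] at h1
    have h2 : (diffOp (g * f) F).IsHomogeneous 0 := by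
      have h3 := diffOp_isHomogeneous (hg.mul hf) hF
      rwa [show s - (k + (s - k)) = 0 by omega] at h3
    rw [actOn_mk, ← diffOp_mul, eq_C_of_isHomogeneous_zero h2, h1, C_0]

theorem finrank_gradedPiece_le [Fintype σ] (hF : F.IsHomogeneous s) {k : ℕ} (hk : k ≤ s) :
    Module.finrank ℝ (gradedPiece F (s - k)) ≤ Module.finrank ℝ (gradedPiece F k) := by
  rw [← Subspace.dual_finrank_eq (K := ℝ) (V := gradedPiece F k)]
  exact LinearMap.finrank_le_finrank_of_injective (poincarePairing_injective hF hk)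

theorem finrank_gradedPiece_symm [Fintype σ] (hF : F.IsHomogeneous s) {k : ℕ} (hk : k ≤ s) :
    Module.finrank ℝ (gradedPiece F (s - k)) = Module.finrank ℝ (gradedPiece F k) := by
  refine le_antisymm (finrank_gradedPiece_le hF hk) ?_
  have h := finrank_gradedPiece_le hF (Nat.sub_le s k)
  rwa [Nat.sub_sub_self hk] at h

/-- `ℓ_a` is a strong Lefschetz element if the higher Hessians of `F` do not vanish at `a`. -/
theorem isStrongLefschetzElement_linearForm [Fintype σ] (hF : F.IsHomogeneous s) (a : σ → ℝ)
    (h : ∀ k, 2 * k ≤ s → ∀ f : MvPolynomial σ ℝ, f.IsHomogeneous k →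
      (∀ g : MvPolynomial σ ℝ, g.IsHomogeneous k → eval a (diffOp (g * f) F) = 0) →
        diffOp f F = 0) :
    IsStrongLefschetzElement (gradedPiece F) s (linearForm F a) := by
  intro k hk
  have hmaps : ∀ x ∈ gradedPiece F k,
      LinearMap.mulLeft ℝ ((linearForm F a : Alg F) ^ (s - 2 * k)) x ∈ gradedPiece F (s - k) := by
    intro x hx
    have h1 := mul_mem_gradedPiece (pow_mem_gradedPiece (linearForm F a).2 (s - 2 * k)) hx
    rwa [show s - 2 * k + k = s - k by omega] at h1
  have hinj : Function.Injective (LinearMap.restrict _ hmaps) := by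
    rw [injective_iff_map_eq_zero]
    rintro ⟨x, hx⟩ h0
    rw [Subtype.ext_iff]
    replace h0 : (linearForm F a : Alg F) ^ (s - 2 * k) * x = 0 := congrArg Subtype.val h0
    obtain ⟨f, hf, rfl⟩ := mem_gradedPiece.1 hx
    replace h0 : Ideal.Quotient.mk (Ann F) ((∑ i, C (a i) * X i) ^ (s - 2 * k) * f) = 0 := by
      rw [map_mul, map_pow]; exact h0
    rw [mk_eq_zero_iff] at h0
    refine mk_eq_zero_iff.2 (h k hk f hf fun g hg => ?_)
    have h1 : (diffOp (g * f) F).IsHomogeneous (s - 2 * k) := by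
      simpa [two_mul] using diffOp_isHomogeneous (hg.mul hf) hF
    -- `ℓ_a ^ (s - 2k)` applied to `g f F` is `(s - 2k)! (g f F)(a)`, but it is also `g` applied to
    -- `ℓ_a ^ (s - 2k) f F = 0`.
    have h2 := eval_diffOp_linear_pow a h1
    rw [← diffOp_mul, mul_left_comm, diffOp_mul, h0, map_zero, map_zero] at h2
    exact (mul_eq_zero.1 h2.symm).resolve_left (Nat.cast_ne_zero.2 (Nat.factorial_ne_zero _))
  have hsurj : Function.Surjective (LinearMap.restrict _ hmaps) :=
    (LinearMap.injective_iff_surjective_of_finrank_eq_finrank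
      (finrank_gradedPiece_symm hF (by omega)).symm).1 hinj
  refine ⟨hmaps, fun x hx y hy hxy => ?_, fun y hy => ?_⟩
  · exact congrArg Subtype.val (@hinj ⟨x, hx⟩ ⟨y, hy⟩ (Subtype.ext hxy))
  · obtain ⟨x, hx⟩ := hsurj ⟨y, hy⟩
    exact ⟨x, x.2, congrArg Subtype.val hx⟩

end Lefschetz

/-! ### Squarefree monomials and higher Hessians of face polynomials. -/

section Squarefree

variable {σ : Type*} [DecidableEq σ]

/-- The squarefree monomial `∏_{v ∈ s} x_v`. -/
def sqfree (s : Finset σ) : MvPolynomial σ ℝ := ∏ v ∈ s, X v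

theorem sqfree_insert {i : σ} {s : Finset σ} (hi : i ∉ s) : sqfree (insert i s) = X i * sqfree s :=
  Finset.prod_insert hi

theorem sqfree_isHomogeneous (s : Finset σ) : (sqfree s).IsHomogeneous s.card := by
  simpa [sqfree] using IsHomogeneous.prod s (fun v => (X v : MvPolynomial σ ℝ)) (fun _ => 1)
    fun v _ => isHomogeneous_X ℝ v

theorem eval_sqfree (a : σ → ℝ) (s : Finset σ) : eval a (sqfree s) = ∏ v ∈ s, a v := by
  simp [sqfree, map_prod]

theorem pderiv_sqfree (i : σ) (s : Finset σ) :
    pderiv i (sqfree s) = if i ∈ s then sqfree (s.erase i) else 0 := by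
  have h0 : ∀ t : Finset σ, i ∉ t → pderiv i (sqfree t) = 0 := by
    intro t
    induction t using Finset.induction_on with
    | empty => simp [sqfree]
    | insert j t hj ih =>
      intro hi
      rw [Finset.mem_insert, not_or] at hi
      rw [sqfree_insert hj, pderiv_mul, ih hi.2, pderiv_X_of_ne (Ne.symm hi.1)]
      simp
  split_ifs with hi
  · conv_lhs => rw [← Finset.insert_erase hi, sqfree_insert (Finset.notMem_erase i s)]
    rw [pderiv_mul, h0 _ (Finset.notMem_erase i s), pderiv_X_self]
    simp
  · exact h0 s hi

theorem diffOp_sqfree (s f : Finset σ) :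
    diffOp (sqfree s) (sqfree f) = if s ⊆ f then sqfree (f \ s) else 0 := by
  induction s using Finset.induction_on with
  | empty => simp [sqfree]
  | insert i s hi ih =>
    rw [sqfree_insert hi, diffOp_mul, ih, diffOp_X]
    by_cases hs : s ⊆ f
    · rw [if_pos hs, pderiv_sqfree, Finset.sdiff_insert]
      simp [Finset.insert_subset_iff, hi, hs]
    · rw [if_neg hs, map_zero, if_neg fun h => hs ((Finset.subset_insert i s).trans h)]

variable {faces : Finset (Finset σ)}

theorem facePolynomial_isHomogeneous {n : ℕ} (h : ∀ f ∈ faces, f.card = n) :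
    (facePolynomial faces).IsHomogeneous n :=
  IsHomogeneous.sum _ _ _ fun f hf => h f hf ▸ sqfree_isHomogeneous f

theorem diffOp_sqfree_facePolynomial (s : Finset σ) :
    diffOp (sqfree s) (facePolynomial faces) = ∑ f ∈ faces with s ⊆ f, sqfree (f \ s) := by
  rw [facePolynomial, map_sum, Finset.sum_filter]
  exact Finset.sum_congr rfl fun f _ => diffOp_sqfree s f

theorem eval_diffOp_sqfree_mul (a : σ → ℝ) (t s : Finset σ) :
    eval a (diffOp (sqfree t * sqfree s) (facePolynomial faces)) =
      ∑ f ∈ faces with t ⊆ f ∧ s ⊆ f \ t, ∏ v ∈ (f \ t) \ s, a v := by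
  rw [mul_comm, diffOp_mul, diffOp_sqfree_facePolynomial, map_sum, map_sum, ← Finset.filter_filter,
    Finset.sum_filter (fun f => s ⊆ f \ t)]
  refine Finset.sum_congr rfl fun f _ => ?_
  rw [diffOp_sqfree]
  split_ifs
  · exact eval_sqfree a _
  · exact map_zero _

theorem diffOp_monomial_facePolynomial_of_two_le {d : σ →₀ ℕ} {i : σ} (hi : 2 ≤ d i) :
    diffOp (monomial d 1) (facePolynomial faces) = 0 := by
  have h1 : (monomial d 1 : MvPolynomial σ ℝ) =
      monomial (d - Finsupp.single i 2) 1 * (X i * X i) := by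
    rw [X, monomial_mul, monomial_mul, ← Finsupp.single_add, one_mul, one_mul,
      tsub_add_cancel_of_le (by simpa using hi)]
  rw [h1, diffOp_mul, diffOp_mul, diffOp_X, diffOp_X, facePolynomial, map_sum, map_sum,
    Finset.sum_eq_zero, map_zero]
  intro f _
  change pderiv i (pderiv i (sqfree f)) = 0
  rw [pderiv_sqfree]
  split_ifs
  · rw [pderiv_sqfree, if_neg (Finset.notMem_erase i f)]
  · exact map_zero _

theorem monomial_eq_sqfree {d : σ →₀ ℕ} (hd : ∀ i, ¬2 ≤ d i) :
    (monomial d 1 : MvPolynomial σ ℝ) = sqfree d.support := by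
  rw [← prod_X_pow_eq_monomial]
  refine Finset.prod_congr rfl fun i hi => ?_
  have := hd i
  rw [Finsupp.mem_support_iff] at hi
  rw [show d i = 1 by omega, pow_one]

theorem card_support_eq_degree {d : σ →₀ ℕ} (hd : ∀ i, ¬2 ≤ d i) : d.support.card = d.degree := by
  rw [Finsupp.degree, Finset.card_eq_sum_ones]
  refine Finset.sum_congr rfl fun i hi => ?_
  have := hd i
  rw [Finsupp.mem_support_iff] at hi
  omega

variable {ι : Type*} {k : ℕ} {v : ι → Finset σ}

/-- The forms `f F` with `f` of degree `k` are spanned by those with `f` a squarefree monomial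
supported in a face. -/
theorem diffOp_mem_span (hv : ∀ f ∈ faces, ∀ s ⊆ f, s.card = k → s ∈ Set.range v)
    {f : MvPolynomial σ ℝ} (hf : f.IsHomogeneous k) :
    diffOp f (facePolynomial faces) ∈
      Submodule.span ℝ (Set.range fun i => diffOp (sqfree (v i)) (facePolynomial faces)) := by
  rw [diffOp_eq_sum]
  refine Submodule.sum_mem _ fun d hd => Submodule.smul_mem _ _ ?_
  by_cases h : ∃ i, 2 ≤ d i
  · obtain ⟨i, hi⟩ := h
    rw [diffOp_monomial_facePolynomial_of_two_le hi]
    exact Submodule.zero_mem _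
  rw [not_exists] at h
  rw [monomial_eq_sqfree h]
  have hdeg : d.support.card = k := by
    rw [card_support_eq_degree h, Finsupp.degree_eq_weight_one]
    exact hf (mem_support_iff.1 hd)
  by_cases hs : ∃ g ∈ faces, d.support ⊆ g
  · obtain ⟨g, hg, hsub⟩ := hs
    obtain ⟨i, hi⟩ := hv g hg _ hsub hdeg
    exact Submodule.subset_span ⟨i, by simp only [hi]⟩
  · rw [diffOp_sqfree_facePolynomial, Finset.filter_eq_empty_iff.2, Finset.sum_empty]
    · exact Submodule.zero_mem _
    · exact fun g hg hsub => hs ⟨g, hg, hsub⟩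

variable [Fintype ι] [DecidableEq ι]

/-- The `k`-th Hessian of the face polynomial at `a`, with respect to squarefree monomials. -/
def higherHessian (faces : Finset (Finset σ)) (v : ι → Finset σ) (a : σ → ℝ) : Matrix ι ι ℝ :=
  Matrix.of fun i j => ∑ f ∈ faces with v i ⊆ f ∧ v j ⊆ f \ v i, ∏ w ∈ (f \ v i) \ v j, a w

theorem higherHessian_mulVec (v : ι → Finset σ) (a : σ → ℝ) (x : ι → ℝ) (i : ι) :
    (higherHessian faces v a).mulVec x i =
      eval a (diffOp (sqfree (v i))
        (∑ j, x j • diffOp (sqfree (v j)) (facePolynomial faces))) := by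
  simp only [Matrix.mulVec, dotProduct, higherHessian, Matrix.of_apply, map_sum, map_smul,
    smul_eval, ← diffOp_mul, eval_diffOp_sqfree_mul, mul_comm]

variable {a : σ → ℝ}

theorem diffOp_eq_zero_of_det_higherHessian_ne_zero
    (hv : ∀ f ∈ faces, ∀ s ⊆ f, s.card = k → s ∈ Set.range v) (hk : ∀ i, (v i).card = k)
    (hdet : (higherHessian faces v a).det ≠ 0) {f : MvPolynomial σ ℝ} (hf : f.IsHomogeneous k)
    (h : ∀ g : MvPolynomial σ ℝ, g.IsHomogeneous k →
      eval a (diffOp (g * f) (facePolynomial faces)) = 0) :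
    diffOp f (facePolynomial faces) = 0 := by
  obtain ⟨x, hx⟩ := (Submodule.mem_span_range_iff_exists_fun ℝ).1 (diffOp_mem_span hv hf)
  have h1 : (higherHessian faces v a).mulVec x = 0 := by
    ext i
    rw [higherHessian_mulVec, hx, ← diffOp_mul]
    exact h _ (hk i ▸ sqfree_isHomogeneous (v i))
  rw [← hx, Matrix.eq_zero_of_mulVec_eq_zero hdet h1]
  simp

/-- A linear relation among the forms `v_i F` is a kernel vector of the Hessian matrix, so these
forms, which span the image of `A_k`, are independent. -/
theorem finrank_gradedPiece_of_det_higherHessian_ne_zero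
    (hv : ∀ f ∈ faces, ∀ s ⊆ f, s.card = k → s ∈ Set.range v) (hk : ∀ i, (v i).card = k)
    (hdet : (higherHessian faces v a).det ≠ 0) :
    Module.finrank ℝ (gradedPiece (facePolynomial faces) k) = Fintype.card ι := by
  have h1 : (gradedPiece (facePolynomial faces) k).map (actOn (facePolynomial faces)) =
      Submodule.span ℝ (Set.range fun i => diffOp (sqfree (v i)) (facePolynomial faces)) := by
    refine le_antisymm ?_ (Submodule.span_le.2 ?_)
    · rintro _ ⟨x, hx, rfl⟩
      obtain ⟨f, hf, rfl⟩ := mem_gradedPiece.1 hx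
      exact diffOp_mem_span hv hf
    · rintro _ ⟨i, rfl⟩
      exact ⟨_, mem_gradedPiece.2 ⟨sqfree (v i), hk i ▸ sqfree_isHomogeneous (v i), rfl⟩, rfl⟩
  have h2 : Function.Injective (actOn (facePolynomial faces)) :=
    (injective_iff_map_eq_zero _).2 fun x => actOn_eq_zero_iff.1
  rw [(Submodule.equivMapOfInjective _ h2 _).finrank_eq, h1]
  refine finrank_span_eq_card (Fintype.linearIndependent_iff.2 fun x hx => ?_)
  refine congrFun (Matrix.eq_zero_of_mulVec_eq_zero hdet ?_)
  ext i
  rw [higherHessian_mulVec, hx]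
  simp

end Squarefree

/-! ### Certified Gaussian elimination modulo a prime. -/

section Elimination

/-- Fraction-free Gaussian elimination modulo `p` on the rows of a matrix with `n` columns: the
output is `true` if a pivot is found in every column. -/
def elimCheck (p : ℕ) : ℕ → List (List ℕ) → Bool
  | 0, _ => true
  | n + 1, rows =>
    match rows.filter fun r => r.headD 0 % p != 0 with
    | [] => false
    | r :: rs =>
      elimCheck p n (((rows.filter fun r => r.headD 0 % p == 0).map List.tail) ++
        rs.map fun q => List.zipWith
          (fun u w => (r.headD 0 * u + (p - 1) * q.headD 0 * w) % p) q.tail r.tail)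

/-- The product of a row of natural numbers with a column vector. -/
def rowDot {R : Type*} [Semiring R] (r : List ℕ) (x : List R) : R :=
  (List.zipWith (fun (a : ℕ) y => (a : R) * y) r x).sum

@[simp] theorem rowDot_cons {R : Type*} [Semiring R] (a : ℕ) (r : List ℕ) (y : R) (x : List R) :
    rowDot (a :: r) (y :: x) = a * y + rowDot r x := by
  simp [rowDot]

theorem rowDot_ofFn {R : Type*} [Semiring R] :
    ∀ {n : ℕ} (a : Fin n → ℕ) (x : Fin n → R),
      rowDot (List.ofFn a) (List.ofFn x) = ∑ i, a i * x i
  | 0, _, _ => by simp [rowDot]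
  | n + 1, a, x => by
    rw [List.ofFn_succ, List.ofFn_succ, rowDot_cons, rowDot_ofFn, Fin.sum_univ_succ]

variable {p : ℕ}

/-- The factor `p - 1` plays the role of `-1`, which keeps the entries natural numbers. Equal
lengths matter because `List.zipWith` truncates. -/
theorem rowDot_zipWith [Fact p.Prime] (a b : ℕ) :
    ∀ (q r : List ℕ) (x : List (ZMod p)), q.length = r.length →
      rowDot (List.zipWith (fun u w => (a * u + (p - 1) * b * w) % p) q r) x =
        a * rowDot q x - b * rowDot r x
  | [], [], x, _ => by simp [rowDot]
  | _ :: _, _ :: _, [], _ => by simp [rowDot]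
  | u :: q, w :: r, y :: x, h => by
    have hp : 1 ≤ p := (Fact.out : p.Prime).one_le
    rw [List.zipWith_cons_cons, rowDot_cons, rowDot_cons, rowDot_cons,
      rowDot_zipWith a b q r x (Nat.succ.inj h)]
    push_cast [ZMod.natCast_mod, Nat.cast_sub hp, ZMod.natCast_self]
    ring

/-- Induction on columns: clearing the first column leaves a system satisfied by the tail of `x`,
which vanishes by induction; the pivot row then kills the first coordinate. -/
theorem eq_zero_of_elimCheck [Fact p.Prime] :
    ∀ (n : ℕ) (rows : List (List ℕ)), elimCheck p n rows = true →
      ∀ x : List (ZMod p), x.length = n → (∀ r ∈ rows, r.length = n) →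
        (∀ r ∈ rows, rowDot r x = 0) → ∀ y ∈ x, y = 0
  | 0, _, _, x, hx, _, _ => by simp [List.length_eq_zero_iff.1 hx]
  | n + 1, rows, h, [], hx, _, _ => by simp
  | n + 1, rows, h, y :: x, hx, hlen, hdot => by
    rw [elimCheck] at h
    split at h
    · exact absurd h (by simp)
    rename_i r rs heq
    have hsub : ∀ q ∈ r :: rs, q ∈ rows ∧ (q.headD 0 % p != 0) = true := fun q hq => by
      rw [← heq] at hq
      exact List.mem_filter.1 hq
    have hdecomp : ∀ q ∈ rows, ∃ b t, q = b :: t ∧ t.length = n ∧ b * y + rowDot t x = 0 := by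
      intro q hq
      match q, hlen q hq, hdot q hq with
      | b :: t, hl, hd => exact ⟨b, t, rfl, Nat.succ.inj hl, by simpa using hd⟩
    obtain ⟨hr, hr0⟩ := hsub r (by simp)
    obtain ⟨a, r, rfl, hrl, hrd⟩ := hdecomp r hr
    have ha : (a : ZMod p) ≠ 0 := by
      rw [Ne, ZMod.natCast_eq_zero_iff, Nat.dvd_iff_mod_eq_zero]
      simpa using hr0
    have key := eq_zero_of_elimCheck n _ h x (Nat.succ.inj hx) ?_ ?_
    · have hx0 : rowDot r x = 0 := by
        refine List.sum_eq_zero fun z hz => ?_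
        obtain ⟨i, hi, rfl⟩ := List.mem_iff_getElem.1 hz
        rw [List.getElem_zipWith, key _ (List.getElem_mem _), mul_zero]
      rw [hx0, add_zero] at hrd
      intro z hz
      rcases List.mem_cons.1 hz with rfl | hz
      · exact (mul_eq_zero.1 hrd).resolve_left ha
      · exact key z hz
    · intro q hq
      rcases List.mem_append.1 hq with hq | hq
      · obtain ⟨q, hq', rfl⟩ := List.mem_map.1 hq
        simp [hlen q (List.mem_filter.1 hq').1]
      · obtain ⟨q, hq', rfl⟩ := List.mem_map.1 hq
        simp [hlen q (hsub q (List.mem_cons_of_mem _ hq')).1, hrl]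
    · intro q hq
      rcases List.mem_append.1 hq with hq | hq
      · obtain ⟨q, hq', rfl⟩ := List.mem_map.1 hq
        obtain ⟨hq1, hq2⟩ := List.mem_filter.1 hq'
        obtain ⟨b, t, rfl, -, hd⟩ := hdecomp q hq1
        have hb : (b : ZMod p) = 0 := by
          rw [ZMod.natCast_eq_zero_iff, Nat.dvd_iff_mod_eq_zero]
          simpa using hq2
        simpa [hb] using hd
      · obtain ⟨q, hq', rfl⟩ := List.mem_map.1 hq
        obtain ⟨b, t, rfl, htl, hd⟩ := hdecomp q (hsub q (List.mem_cons_of_mem _ hq')).1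
        simp only [List.headD_cons, List.tail_cons]
        rw [rowDot_zipWith _ _ _ _ _ (by rw [htl, hrl])]
        linear_combination (a : ZMod p) * hd - (b : ZMod p) * hrd

/-- If the real determinant vanished, so would the integer one and its residue modulo `p`, giving a
nonzero kernel vector over `ZMod p`. -/
theorem det_ne_zero_of_elimCheck {α : Type*} (p : ℕ) [Fact p.Prime] (L : List α) (M : α → α → ℕ)
    (h : elimCheck p L.length (L.map fun t => L.map (M t)) = true) :
    (Matrix.of fun i j : Fin L.length => (M (L.get i) (L.get j) : ℝ)).det ≠ 0 := by
  intro h0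
  set N : Matrix (Fin L.length) (Fin L.length) ℤ := Matrix.of fun i j => (M (L.get i) (L.get j) : ℤ)
  have h1 : N.det = 0 := by
    have h2 := (Int.castRingHom ℝ).map_det N
    have h3 : (Int.castRingHom ℝ).mapMatrix N =
        Matrix.of fun i j : Fin L.length => (M (L.get i) (L.get j) : ℝ) := by
      ext i j; simp [N]
    rw [h3, h0] at h2
    exact Int.cast_eq_zero.1 h2
  have h2 : ((Int.castRingHom (ZMod p)).mapMatrix N).det = 0 := by
    rw [← RingHom.map_det, h1, map_zero]
  obtain ⟨x, hx, hx0⟩ := Matrix.exists_mulVec_eq_zero_iff.2 h2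
  refine hx (funext fun i => eq_zero_of_elimCheck _ _ h (List.ofFn x) (by simp) ?_ ?_ (x i)
    (List.mem_ofFn.2 ⟨i, rfl⟩))
  · intro r hr
    obtain ⟨t, -, rfl⟩ := List.mem_map.1 hr
    simp
  · intro r hr
    obtain ⟨t, ht, rfl⟩ := List.mem_map.1 hr
    obtain ⟨i, rfl⟩ := List.get_of_mem ht
    have h4 : L.map (M (L.get i)) = List.ofFn fun j => M (L.get i) (L.get j) := by
      rw [← Function.comp_def, ← List.map_ofFn, List.ofFn_get]
    rw [h4, rowDot_ofFn]
    simpa [N, Matrix.mulVec, dotProduct] using congrFun hx0 i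

end Elimination

/-! ### Vertex sets encoded as binary numbers. -/

section Masks

/-- The set of the positions of the binary digits `1` of `n`. -/
def bits (n : ℕ) : Finset (Fin 20) := Finset.univ.filter fun i => n.testBit i

theorem mem_bits {n : ℕ} {i : Fin 20} : i ∈ bits n ↔ n.testBit i = true := by simp [bits]

/-- Digits from position 20 on are invisible to `bits`, so `m` must have none; `n` may. -/
theorem bits_subset_iff {m n : ℕ} (hm : m < 2 ^ 20) : bits m ⊆ bits n ↔ m &&& n = m := by
  refine ⟨fun h => Nat.eq_of_testBit_eq fun i => ?_, fun h i hi => ?_⟩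
  · rcases lt_or_ge i 20 with hi | hi
    · have := @h ⟨i, hi⟩
      rw [mem_bits, mem_bits] at this
      rw [Nat.testBit_and]
      cases h1 : m.testBit i
      · simp
      · simpa using this h1
    · rw [Nat.testBit_and,
        Nat.testBit_lt_two_pow (hm.trans_le (Nat.pow_le_pow_right (by norm_num) hi)),
        Bool.false_and]
  · rw [mem_bits] at hi ⊢
    rw [← h, Nat.testBit_and, Bool.and_eq_true] at hi
    exact hi.2

theorem bits_and (m n : ℕ) : bits (m &&& n) = bits m ∩ bits n := by
  ext i; simp [mem_bits]

theorem bits_or (m n : ℕ) : bits (m ||| n) = bits m ∪ bits n := by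
  ext i; simp [mem_bits]

theorem bits_zero : bits 0 = ∅ := by
  ext i; simp [mem_bits]

theorem disjoint_bits_iff {m n : ℕ} (hm : m < 2 ^ 20) :
    Disjoint (bits m) (bits n) ↔ m &&& n = 0 := by
  rw [Finset.disjoint_iff_inter_eq_empty, ← bits_and, ← Finset.subset_empty, ← bits_zero,
    bits_subset_iff (Nat.and_le_left.trans_lt hm), Nat.and_zero, eq_comm]

theorem bits_xor {m n : ℕ} (h : bits m ⊆ bits n) : bits (n ^^^ m) = bits n \ bits m := by
  ext i
  have := @h i
  rw [mem_bits, mem_bits] at this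
  rw [Finset.mem_sdiff, mem_bits, mem_bits, mem_bits, Nat.testBit_xor]
  cases h1 : m.testBit i <;> simp_all

theorem bits_two_pow (i : Fin 20) : bits (2 ^ i.val) = {i} := by
  ext j
  rw [mem_bits, Nat.testBit_two_pow, Finset.mem_singleton, decide_eq_true_iff, Fin.ext_iff, eq_comm]

theorem bits_two_pow_or (i j : Fin 20) : bits (2 ^ i.val ||| 2 ^ j.val) = {i, j} := by
  rw [bits_or, bits_two_pow, bits_two_pow]; rfl

end Masks

/-! ### Computations for the dodecahedron: Hilbert series and strong Lefschetz property. -/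

section Dodecahedron

/-- The faces of the dodecahedron as binary numbers. -/
def faceMasks : List ℕ :=
  [62, 524486, 397, 66328, 132656, 263266, 63488, 203264, 406528, 811072, 573569, 100609]

/-- The entry for the sets `a` and `b` of the higher Hessian of the dodecahedron at the point with
coordinates `0` on the set `z` and `1` elsewhere. -/
def maskCount (z a b : ℕ) : ℕ :=
  (((faceMasks.filter fun f => a &&& f == a).map (· ^^^ a)).filter fun g =>
    b &&& g == b && z &&& (g ^^^ b) == 0).length

/-- The singletons as binary numbers. -/
def vertexMasks : List ℕ := (List.finRange 20).map fun i => 2 ^ i.val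

/-- The number of faces containing `i` and `j`. -/
def commonFaces (i j : Fin 20) : ℕ := faceMasks.countP fun f => f.testBit i && f.testBit j

/-- The pairs of vertices for which the number of common faces satisfies `P`. -/
def pairMasksOf (P : ℕ → Prop) [DecidablePred P] : List ℕ :=
  ((List.finRange 20 ×ˢ List.finRange 20).filter fun q => q.1 < q.2 ∧ P (commonFaces q.1 q.2)).map
    fun q => 2 ^ q.1.val ||| 2 ^ q.2.val

/-- The diagonals of the faces, followed by the edges. -/
def pairMasks : List ℕ := pairMasksOf (· = 1) ++ pairMasksOf (1 < ·)

/-- The mask `2` encodes the zero set `{1}` of `pointC`; below, `1984 = 2^6 + ⋯ + 2^10` encodes that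
of `pointB`. -/
theorem elimCheck_empty :
    elimCheck 5 [0].length ([0].map fun a => [0].map (maskCount 2 a)) = true := by
  decide +kernel

theorem elimCheck_vertexMasks :
    elimCheck 5 vertexMasks.length (vertexMasks.map fun a => vertexMasks.map (maskCount 2 a)) =
      true := by
  decide +kernel

/-- A diagonal lies in a single face, so its column has at most three nonzero entries; the order of
`pairMasks` eliminates these sparse columns first. -/
theorem elimCheck_pairMasks :
    elimCheck 5 pairMasks.length (pairMasks.map fun a => pairMasks.map (maskCount 2 a)) = true := by
  decide +kernel

theorem elimCheck_vertexMasks_pointB :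
    elimCheck 5 vertexMasks.length (vertexMasks.map fun a => vertexMasks.map (maskCount 1984 a)) =
      true := by
  decide +kernel

theorem length_pairMasks : pairMasks.length = 90 := by decide +kernel

theorem faceMasks_nodup : (faceMasks.map bits).Nodup := by decide +kernel

theorem dodecahedronFaces_eq : dodecahedronFaces = (faceMasks.map bits).toFinset := by
  decide +kernel

theorem exists_mask {f : Finset (Fin 20)} (hf : f ∈ dodecahedronFaces) :
    ∃ m ∈ faceMasks, bits m = f := by
  rw [dodecahedronFaces_eq] at hf
  simpa using hf

theorem card_bits_of_mem_faceMasks : ∀ m ∈ faceMasks, (bits m).card = 5 := by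
  decide +kernel

theorem dodecahedronPolynomial_isHomogeneous : dodecahedronPolynomial.IsHomogeneous 5 :=
  facePolynomial_isHomogeneous fun f hf => by
    obtain ⟨m, hm, rfl⟩ := exists_mask hf
    exact card_bits_of_mem_faceMasks m hm

theorem prod_eq_ite {z : ℕ} {c : Fin 20 → ℝ} (hc : ∀ i, c i = if i ∈ bits z then 0 else 1)
    (s : Finset (Fin 20)) : ∏ w ∈ s, c w = if Disjoint (bits z) s then 1 else 0 := by
  split_ifs with h
  · exact Finset.prod_eq_one fun w hw => by
      rw [hc, if_neg (Finset.disjoint_right.1 h hw)]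
  · obtain ⟨w, hw, hw'⟩ := Finset.not_disjoint_iff.1 h
    exact Finset.prod_eq_zero hw' (by rw [hc, if_pos hw])

theorem sum_eq_maskCount {z : ℕ} (hz : z < 2 ^ 20) {c : Fin 20 → ℝ}
    (hc : ∀ i, c i = if i ∈ bits z then 0 else 1) {a b : ℕ} (ha : a < 2 ^ 20) (hb : b < 2 ^ 20) :
    ∑ f ∈ dodecahedronFaces with bits a ⊆ f ∧ bits b ⊆ f \ bits a,
      ∏ w ∈ (f \ bits a) \ bits b, c w = maskCount z a b := by
  rw [dodecahedronFaces_eq, Finset.sum_filter, List.sum_toFinset _ faceMasks_nodup, List.map_map,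
    maskCount, ← List.countP_eq_length_filter, List.countP_map, List.countP_filter]
  -- Both sides are additive over the list of faces, so they can be compared face by face.
  generalize faceMasks = l
  induction l with
  | nil => simp
  | cons f l ih =>
    rw [List.map_cons, List.sum_cons, ih, List.countP_cons, Nat.cast_add, add_comm]
    congr 1
    simp only [Function.comp_apply, prod_eq_ite hc]
    by_cases h1 : bits a ⊆ bits f
    · have h2 := bits_xor h1
      by_cases h3 : bits b ⊆ bits f \ bits a
      · have h4 := bits_xor (h2 ▸ h3)
        rw [h2] at h4
        simp only [if_pos (And.intro h1 h3), ← h4, disjoint_bits_iff hz]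
        rw [← h2, bits_subset_iff hb] at h3
        rw [bits_subset_iff ha] at h1
        simp [h1, h3]
      · rw [if_neg fun h => h3 h.2]
        rw [← h2, bits_subset_iff hb] at h3
        simp [h3]
    · rw [if_neg fun h => h1 h.1]
      rw [bits_subset_iff ha] at h1
      simp [h1]

theorem pointC_eq_ite (i : Fin 20) : pointC i = if i ∈ bits 2 then 0 else 1 := by
  have h : bits 2 = {1} := bits_two_pow 1
  simp only [pointC, h, Finset.mem_singleton]

theorem pointB_eq_ite (i : Fin 20) : pointB i = if i ∈ bits 1984 then 0 else 1 := by
  have h : bits 1984 = {6, 7, 8, 9, 10} := by decide +kernel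
  simp only [pointB, h]

theorem det_higherHessian_ne_zero {z : ℕ} (hz : z < 2 ^ 20) {c : Fin 20 → ℝ}
    (hc : ∀ i, c i = if i ∈ bits z then 0 else 1) (L : List ℕ) (hL : ∀ m ∈ L, m < 2 ^ 20)
    (h : elimCheck 5 L.length (L.map fun a => L.map (maskCount z a)) = true) :
    (higherHessian dodecahedronFaces (fun i => bits (L.get i)) c).det ≠ 0 := by
  have : Fact (Nat.Prime 5) := ⟨by norm_num⟩
  have h1 := det_ne_zero_of_elimCheck 5 L (maskCount z) h
  have h2 : higherHessian dodecahedronFaces (fun i => bits (L.get i)) c =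
      Matrix.of fun i j : Fin L.length => (maskCount z (L.get i) (L.get j) : ℝ) := by
    ext i j
    exact sum_eq_maskCount hz hc (hL _ (L.get_mem i)) (hL _ (L.get_mem j))
  rwa [h2]

theorem two_pow_lt (i : Fin 20) : 2 ^ i.val < 2 ^ 20 :=
  Nat.pow_lt_pow_right (by norm_num) i.2

theorem exists_of_mem_vertexMasks {m : ℕ} (hm : m ∈ vertexMasks) :
    ∃ i : Fin 20, 2 ^ i.val = m := by
  obtain ⟨i, -, rfl⟩ := List.mem_map.1 hm
  exact ⟨i, rfl⟩

theorem lt_of_mem_vertexMasks {m : ℕ} (hm : m ∈ vertexMasks) : m < 2 ^ 20 := by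
  obtain ⟨i, rfl⟩ := exists_of_mem_vertexMasks hm
  exact two_pow_lt i

/-- In the degrees `0`, `1` and `2` the squarefree monomials supported in a face are encoded by a
list of binary numbers for which the higher Hessian at `pointC` is invertible. -/
theorem exists_masks (k : ℕ) (hk : k ≤ 2) :
    ∃ L : List ℕ, L.length = ![1, 20, 90] (Fin.ofNat 3 k) ∧
      (∀ f ∈ dodecahedronFaces, ∀ s ⊆ f, s.card = k →
        s ∈ Set.range fun i => bits (L.get i)) ∧
      (∀ i, (bits (L.get i)).card = k) ∧
      (higherHessian dodecahedronFaces (fun i => bits (L.get i)) pointC).det ≠ 0 := by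
  have hrange : ∀ {L : List ℕ} {m : ℕ} {s : Finset (Fin 20)}, m ∈ L → bits m = s →
      s ∈ Set.range fun i => bits (L.get i) := by
    rintro L m s hm rfl
    obtain ⟨i, rfl⟩ := List.get_of_mem hm
    exact ⟨i, rfl⟩
  interval_cases k
  · refine ⟨[0], rfl, fun f _ s _ hs => hrange (List.mem_singleton_self 0) ?_, fun i => ?_,
      det_higherHessian_ne_zero (by norm_num) pointC_eq_ite _ (by simp) elimCheck_empty⟩
    · rw [bits_zero, Finset.card_eq_zero.1 hs]
    · have := List.eq_of_mem_singleton ([0].get_mem i)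
      rw [this, bits_zero, Finset.card_empty]
  · refine ⟨vertexMasks, by simp [vertexMasks, Fin.ofNat], fun f _ s _ hs => ?_, fun i => ?_,
      det_higherHessian_ne_zero (by norm_num) pointC_eq_ite _ (fun m hm => lt_of_mem_vertexMasks hm)
        elimCheck_vertexMasks⟩
    · obtain ⟨i, rfl⟩ := Finset.card_eq_one.1 hs
      exact hrange (List.mem_map_of_mem (List.mem_finRange i)) (bits_two_pow i)
    · obtain ⟨j, hj⟩ := exists_of_mem_vertexMasks (vertexMasks.get_mem i)
      rw [← hj, bits_two_pow, Finset.card_singleton]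
  · have hmem : ∀ m ∈ pairMasks, ∃ i j : Fin 20, i < j ∧ 2 ^ i.val ||| 2 ^ j.val = m := by
      intro m hm
      rcases List.mem_append.1 hm with hm | hm <;>
      · obtain ⟨q, hq, rfl⟩ := List.mem_map.1 hm
        exact ⟨q.1, q.2, (of_decide_eq_true (List.mem_filter.1 hq).2).1, rfl⟩
    refine ⟨pairMasks, by simp [length_pairMasks, Fin.ofNat], fun f hf s hs hcard => ?_,
      fun i => ?_, det_higherHessian_ne_zero (by norm_num) pointC_eq_ite _ (fun m hm => ?_)
        elimCheck_pairMasks⟩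
    · obtain ⟨n, hn, rfl⟩ := exists_mask hf
      have key : ∀ i j : Fin 20, i < j → i ∈ bits n → j ∈ bits n →
          ({i, j} : Finset (Fin 20)) ∈ Set.range fun i => bits (pairMasks.get i) := by
        intro i j hij hi hj
        refine hrange ?_ (bits_two_pow_or i j)
        have hpos : 0 < commonFaces i j :=
          List.countP_pos_iff.2 ⟨n, hn, Bool.and_eq_true_iff.2 ⟨mem_bits.1 hi, mem_bits.1 hj⟩⟩
        have hprod := List.pair_mem_product.2 ⟨List.mem_finRange i, List.mem_finRange j⟩
        have hmem' : ∀ (P : ℕ → Prop) [DecidablePred P], P (commonFaces i j) →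
            2 ^ i.val ||| 2 ^ j.val ∈ pairMasksOf P := fun P _ hP =>
          List.mem_map.2 ⟨(i, j), List.mem_filter.2 ⟨hprod, decide_eq_true ⟨hij, hP⟩⟩, rfl⟩
        rcases (Nat.succ_le_of_lt hpos).eq_or_lt with h | h
        · exact List.mem_append_left _ (hmem' _ h.symm)
        · exact List.mem_append_right _ (hmem' _ h)
      obtain ⟨i, j, hij, rfl⟩ := Finset.card_eq_two.1 hcard
      have hi : i ∈ bits n := hs (by simp)
      have hj : j ∈ bits n := hs (by simp)
      rcases lt_or_gt_of_ne hij with h | h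
      · exact key i j h hi hj
      · rw [Finset.pair_comm]
        exact key j i h hj hi
    · obtain ⟨a, b, hab, hj⟩ := hmem _ (pairMasks.get_mem i)
      rw [← hj, bits_two_pow_or, Finset.card_pair hab.ne]
    · obtain ⟨i, j, -, rfl⟩ := hmem m hm
      exact Nat.or_lt_two_pow (two_pow_lt i) (two_pow_lt j)

theorem isStrongLefschetzElement_pointC :
    IsStrongLefschetzElement (gradedPiece dodecahedronPolynomial) 5
      (linearForm dodecahedronPolynomial pointC) := by
  refine isStrongLefschetzElement_linearForm dodecahedronPolynomial_isHomogeneous _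
    fun k hk f hf h => ?_
  obtain ⟨L, -, hv, hcard, hdet⟩ := exists_masks k (by omega)
  exact diffOp_eq_zero_of_det_higherHessian_ne_zero hv hcard hdet hf h

theorem finrank_gradedPiece_dodecahedronPolynomial (k : Fin 6) :
    Module.finrank ℝ (gradedPiece dodecahedronPolynomial k) = ![1, 20, 90, 90, 20, 1] k := by
  have h : ∀ k ≤ 2, Module.finrank ℝ (gradedPiece dodecahedronPolynomial k) =
      ![1, 20, 90] (Fin.ofNat 3 k) := by
    intro k hk
    obtain ⟨L, hL, hv, hcard, hdet⟩ := exists_masks k hk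
    rw [dodecahedronPolynomial, finrank_gradedPiece_of_det_higherHessian_ne_zero hv hcard hdet,
      Fintype.card_fin, hL]
  have h' : ∀ k ≤ 2, Module.finrank ℝ (gradedPiece dodecahedronPolynomial (5 - k)) =
      ![1, 20, 90] (Fin.ofNat 3 k) := fun k hk => by
    rw [finrank_gradedPiece_symm dodecahedronPolynomial_isHomogeneous (by omega), h k hk]
  fin_cases k
  · exact h 0 (by norm_num)
  · exact h 1 (by norm_num)
  · exact h 2 (by norm_num)
  · exact h' 2 (by norm_num)
  · exact h' 1 (by norm_num)
  · exact h' 0 (by norm_num)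

end Dodecahedron

/-! ### Counting positive eigenvalues. -/

section Signature

variable {n : Type*} [Fintype n] [DecidableEq n] {M : Matrix n n ℝ}

theorem dotProduct_mulVec_eq_sum_eigenvalues (hM : M.IsHermitian) (y : n → ℝ) :
    y ⬝ᵥ M.mulVec y =
      ∑ i, hM.eigenvalues i * ((hM.eigenvectorBasis i).ofLp ⬝ᵥ y) ^ 2 := by
  have h := hM.eigenvectorBasis.sum_inner_mul_inner (WithLp.toLp 2 y) (WithLp.toLp 2 (M.mulVec y))
  simp only [EuclideanSpace.inner_eq_star_dotProduct, star_trivial] at h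
  rw [dotProduct_comm, ← h]
  refine Finset.sum_congr rfl fun i _ => ?_
  have h1 : M.mulVec y ⬝ᵥ (hM.eigenvectorBasis i).ofLp =
      hM.eigenvalues i * ((hM.eigenvectorBasis i).ofLp ⬝ᵥ y) := by
    have hT : M.transpose = M := by simpa [Matrix.IsHermitian] using hM
    rw [dotProduct_comm, Matrix.dotProduct_mulVec, ← Matrix.mulVec_transpose, hT,
      hM.mulVec_eigenvectorBasis, smul_dotProduct, smul_eq_mul]
  rw [h1]
  ring

/-- A symmetric matrix whose form is positive definite on an `m`-dimensional space has at least
`m` positive eigenvalues. -/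
theorem le_card_pos_eigenvalues (hM : M.IsHermitian) {m : ℕ} (T : (Fin m → ℝ) →ₗ[ℝ] (n → ℝ))
    (hT : ∀ x, x ≠ 0 → 0 < T x ⬝ᵥ M.mulVec (T x)) :
    m ≤ (Finset.univ.filter fun i => 0 < hM.eigenvalues i).card := by
  let Φ : (Fin m → ℝ) →ₗ[ℝ] ({i // 0 < hM.eigenvalues i} → ℝ) :=
    LinearMap.pi fun i =>
      (dotProductBilin ℝ ℝ (hM.eigenvectorBasis i).ofLp).comp T
  -- A vector orthogonal to all eigenvectors of positive eigenvalue has nonpositive square, so no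
  -- nonzero `x` lies in the kernel of `Φ`.
  have hinj : Function.Injective Φ := by
    rw [injective_iff_map_eq_zero]
    intro x hx
    by_contra hx0
    refine absurd (hT x hx0) (not_lt.2 ?_)
    rw [dotProduct_mulVec_eq_sum_eigenvalues hM]
    refine Finset.sum_nonpos fun i _ => ?_
    rcases lt_or_ge 0 (hM.eigenvalues i) with hi | hi
    · have h1 : (hM.eigenvectorBasis i).ofLp ⬝ᵥ T x = 0 := congrFun hx ⟨i, hi⟩
      rw [h1]
      simp
    · exact mul_nonpos_of_nonpos_of_nonneg hi (sq_nonneg _)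
  have h := LinearMap.finrank_le_finrank_of_injective hinj
  rwa [Module.finrank_fin_fun, Module.finrank_fintype_fun_eq_card, Fintype.card_subtype] at h

end Signature

/-! ### The Hodge–Riemann relation in degree one. -/

section Hessian

variable {σ : Type*} [Fintype σ]

theorem eval_diffOp_linear_mul_linear (F : MvPolynomial σ ℝ) (a x y : σ → ℝ) :
    eval a (diffOp ((∑ i, C (x i) * X i) * ∑ i, C (y i) * X i) F) =
      x ⬝ᵥ (hessian F a).mulVec y := by
  have h : ∀ (z : σ → ℝ) (G : MvPolynomial σ ℝ),
      diffOp (∑ i, C (z i) * X i) G = ∑ i, z i • pderiv i G := fun z G => by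
    rw [diffOp_sum]
    exact Finset.sum_congr rfl fun i _ => by rw [diffOp_mul, diffOp_C, diffOp_X]
  rw [diffOp_mul, h, h]
  simp only [map_sum, Derivation.map_smul, smul_eval, dotProduct, Matrix.mulVec, hessian,
    Matrix.of_apply, mul_comm]

/-- In degree one the Hodge–Riemann relation says that the Hessian is negative definite on the
orthogonal complement of `a`. -/
theorem not_satisfiesHodgeRiemann {F : MvPolynomial σ ℝ} {s : ℕ} (hF : F.IsHomogeneous s)
    (hs : 2 ≤ s) {a y : σ → ℝ} (h0 : a ⬝ᵥ (hessian F a).mulVec y = 0)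
    (hy : 0 < y ⬝ᵥ (hessian F a).mulVec y) :
    ¬ SatisfiesHodgeRiemann (gradedPiece F) s (poincare F) (linearForm F a) := by
  intro h
  set ℓ : MvPolynomial σ ℝ := ∑ i, C (a i) * X i
  set f : MvPolynomial σ ℝ := ∑ i, C (y i) * X i
  have hℓ : ℓ.IsHomogeneous 1 := isHomogeneous_linear a
  have hf : f.IsHomogeneous 1 := isHomogeneous_linear y
  rw [← eval_diffOp_linear_mul_linear] at h0 hy
  have hfF : (diffOp f F).IsHomogeneous (s - 1) := diffOp_isHomogeneous hf hF
  have hffF : (diffOp (f * f) F).IsHomogeneous (s - 2) := diffOp_isHomogeneous (hf.mul hf) hF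
  have hs1 : s - 2 * 1 + 1 = s - 1 := by omega
  -- `ℓ ^ (s - 1) f F = (s - 1)! (f F)(a)`, while orthogonality to `a` says `(s - 1) (f F)(a) = 0`
  -- by Euler; `s ≥ 2` allows the division.
  have h1 : diffOp (ℓ ^ (s - 2 * 1 + 1) * f) F = 0 := by
    have h2 : eval a (diffOp f F) = 0 := by
      rw [diffOp_mul, eval_diffOp_linear hfF] at h0
      refine (mul_eq_zero.1 h0).resolve_left (Nat.cast_ne_zero.2 (by omega))
    have h3 : (diffOp (ℓ ^ (s - 1)) (diffOp f F)).IsHomogeneous 0 := by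
      simpa using diffOp_isHomogeneous (hℓ.pow (s - 1)) hfF
    rw [hs1, diffOp_mul, eq_C_of_isHomogeneous_zero h3, ← eval_eq_constantCoeff h3 a,
      eval_diffOp_linear_pow a hfF, h2, mul_zero, C_0]
  have h4 := h 1 (by omega) (Ideal.Quotient.mk (Ann F) f) (mem_gradedPiece.2 ⟨f, hf, rfl⟩)
    (mk_eq_zero_iff.2 h1) (fun h5 => ?_)
  -- The pairing equals `(s - 2)!` times the Hessian square of `y`, which is positive and
  -- contradicts the sign `(-1) ^ 1`.
  · change 0 < (-1) ^ 1 * constantCoeff (diffOp (f * (ℓ ^ (s - 2 * 1) * f)) F) at h4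
    have h6 : (diffOp (ℓ ^ (s - 2)) (diffOp (f * f) F)).IsHomogeneous 0 := by
      simpa using diffOp_isHomogeneous (hℓ.pow (s - 2)) hffF
    rw [mul_left_comm, mul_one, diffOp_mul, ← eval_eq_constantCoeff h6 a,
      eval_diffOp_linear_pow a hffF] at h4
    have h7 : 0 < ((s - 2).factorial : ℝ) * eval a (diffOp (f * f) F) :=
      mul_pos (Nat.cast_pos.2 (Nat.factorial_pos _)) hy
    linarith
  · rw [diffOp_mul, mk_eq_zero_iff.1 h5, map_zero, map_zero] at hy
    exact lt_irrefl _ hy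

end Hessian

/-! ### The Hessian of the dodecahedron at `pointB`. -/

section Dodecahedron

theorem hessian_facePolynomial {σ : Type*} [DecidableEq σ] (faces : Finset (Finset σ))
    (a : σ → ℝ) :
    hessian (facePolynomial faces) a = higherHessian faces (fun i => {i}) a := by
  ext i j
  have h : pderiv i (pderiv j (facePolynomial faces)) =
      diffOp (sqfree {i} * sqfree {j}) (facePolynomial faces) := by
    simp [sqfree]
  rw [hessian, Matrix.of_apply, h, eval_diffOp_sqfree_mul, higherHessian, Matrix.of_apply]

theorem hessian_pointB_apply (i j : Fin 20) :
    hessian dodecahedronPolynomial pointB i j = maskCount 1984 (2 ^ i.val) (2 ^ j.val) := by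
  rw [dodecahedronPolynomial, hessian_facePolynomial,
    ← sum_eq_maskCount (by norm_num) pointB_eq_ite (two_pow_lt i) (two_pow_lt j), bits_two_pow,
    bits_two_pow]
  rfl

theorem det_hessian_pointB_ne_zero : (hessian dodecahedronPolynomial pointB).det ≠ 0 := by
  have h := det_higherHessian_ne_zero (by norm_num) pointB_eq_ite vertexMasks
    (fun m hm => lt_of_mem_vertexMasks hm) elimCheck_vertexMasks_pointB
  have hlen : vertexMasks.length = 20 := by simp [vertexMasks]
  have h1 : higherHessian dodecahedronFaces (fun i => bits (vertexMasks.get i)) pointB =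
      (hessian dodecahedronPolynomial pointB).submatrix (finCongr hlen) (finCongr hlen) := by
    have h2 : ∀ i, bits (vertexMasks.get i) = {finCongr hlen i} := fun i => by
      have h3 : ∀ (n : ℕ) (h : n < vertexMasks.length), vertexMasks[n] = 2 ^ n := fun n h => by
        simp [vertexMasks]
      rw [← bits_two_pow, List.get_eq_getElem, h3]
      rfl
    simp only [h2, dodecahedronPolynomial, hessian_facePolynomial]
    rfl
  rwa [h1, Matrix.det_submatrix_equiv_self] at h

/-- The indicator vector of a set of vertices. -/
def indicatorVec (s : Finset (Fin 20)) : Fin 20 → ℝ := fun i => if i ∈ s then 1 else 0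

theorem indicatorVec_dotProduct_hessian (s t : Finset (Fin 20)) :
    indicatorVec s ⬝ᵥ (hessian dodecahedronPolynomial pointB).mulVec (indicatorVec t) =
      ((∑ i ∈ s, ∑ j ∈ t, maskCount 1984 (2 ^ i.val) (2 ^ j.val) : ℕ) : ℝ) := by
  simp [dotProduct, Matrix.mulVec, indicatorVec, hessian_pointB_apply]

/-- Three pairs of vertices whose indicator vectors are orthogonal for the Hessian at `pointB`. -/
def positivePairs : Fin 3 → Finset (Fin 20) := ![{1, 2}, {9, 16}, {6, 19}]

/-- Each pair is an edge in two faces, exactly one of which avoids `{6, …, 10}` once the edge is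
removed; this gives `1 + 1` on the diagonal. A face meeting two of the pairs always keeps a zero
coordinate after one vertex of each is removed. -/
theorem positivePairs_gram (k l : Fin 3) :
    indicatorVec (positivePairs k) ⬝ᵥ
      (hessian dodecahedronPolynomial pointB).mulVec (indicatorVec (positivePairs l)) =
        if k = l then 2 else 0 := by
  have h : ∀ k l : Fin 3, ∑ i ∈ positivePairs k, ∑ j ∈ positivePairs l,
      maskCount 1984 (2 ^ i.val) (2 ^ j.val) = if k = l then 2 else 0 := by decide +kernel
  rw [indicatorVec_dotProduct_hessian, h]
  split_ifs <;> simp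

theorem two_lt_card_pos_eigenvalues :
    2 < (Finset.univ.filter fun i : Fin 20 =>
      0 < (hessian_isHermitian dodecahedronPolynomial pointB).eigenvalues i).card := by
  refine le_card_pos_eigenvalues (m := 3) _
    (Fintype.linearCombination ℝ fun k => indicatorVec (positivePairs k)) fun x hx => ?_
  have h1 : Fintype.linearCombination ℝ (fun k => indicatorVec (positivePairs k)) x ⬝ᵥ
      (hessian dodecahedronPolynomial pointB).mulVec
        (Fintype.linearCombination ℝ (fun k => indicatorVec (positivePairs k)) x) =
      ∑ k, 2 * x k ^ 2 := by
    simp only [Fintype.linearCombination_apply, Matrix.mulVec_sum, Matrix.mulVec_smul,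
      sum_dotProduct, dotProduct_sum, smul_dotProduct, dotProduct_smul, positivePairs_gram,
      smul_eq_mul]
    refine Finset.sum_congr rfl fun k _ => ?_
    simp
    ring
  rw [h1]
  obtain ⟨k, hk⟩ := Function.ne_iff.1 hx
  have hk : x k ≠ 0 := hk
  exact Finset.sum_pos' (fun _ _ => by positivity) ⟨k, Finset.mem_univ k, by positivity⟩

theorem not_satisfiesHodgeRiemann_pointB :
    ¬ SatisfiesHodgeRiemann (gradedPiece dodecahedronPolynomial) 5
      (poincare dodecahedronPolynomial) (linearForm dodecahedronPolynomial pointB) := by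
  refine not_satisfiesHodgeRiemann dodecahedronPolynomial_isHomogeneous (by norm_num)
    -- The edges `{9, 16}` and `{6, 19}` are exchanged by a reflection of the dodecahedron
    -- preserving `{6, …, 10}`, so they pair equally with `b` and the difference is orthogonal to
    -- `b`. Its square is `2 + 2`.
    (y := indicatorVec (positivePairs 1) - indicatorVec (positivePairs 2)) ?_ ?_
  · have hb : pointB = indicatorVec (bits 1984)ᶜ := by
      ext i
      simp [pointB_eq_ite, indicatorVec]
    have h : ∑ i ∈ (bits 1984)ᶜ, ∑ j ∈ positivePairs 1, maskCount 1984 (2 ^ i.val) (2 ^ j.val) =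
        ∑ i ∈ (bits 1984)ᶜ, ∑ j ∈ positivePairs 2, maskCount 1984 (2 ^ i.val) (2 ^ j.val) := by
      decide +kernel
    have h' := fun k => indicatorVec_dotProduct_hessian (bits 1984)ᶜ (positivePairs k)
    simp only [← hb] at h'
    rw [Matrix.mulVec_sub, dotProduct_sub, sub_eq_zero, h', h', h]
  · simp only [Matrix.mulVec_sub, dotProduct_sub, sub_dotProduct, positivePairs_gram,
      Fin.reduceEq, if_true, if_false]
    norm_num

end Dodecahedron

end PolyhedralAlgebra

end
open PolyhedralAlgebra in
theorem mainTheorem2 :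
    -- the algebra is graded with socle degree 5 and Hilbert series (1, 20, 90, 90, 20, 1)
    (DirectSum.IsInternal (gradedPiece dodecahedronPolynomial) ∧
      (∀ k, 5 < k → gradedPiece dodecahedronPolynomial k = ⊥) ∧
      (∀ k : Fin 6, Module.finrank ℝ (gradedPiece dodecahedronPolynomial k) =
        ![1, 20, 90, 90, 20, 1] k)) ∧
    -- the strong Lefschetz property, and the witness
    HasStrongLefschetzProperty (gradedPiece dodecahedronPolynomial) 5 ∧
    IsStrongLefschetzElement (gradedPiece dodecahedronPolynomial) 5
      (linearForm dodecahedronPolynomial pointC) ∧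
    -- the Hessian at the second point
    (hessian dodecahedronPolynomial pointB).det ≠ 0 ∧
    2 < (Finset.univ.filter fun i : Fin 20 =>
      0 < (hessian_isHermitian dodecahedronPolynomial pointB).eigenvalues i).card ∧
    -- the failure of the Hodge–Riemann relation
    ¬ SatisfiesHodgeRiemann (gradedPiece dodecahedronPolynomial) 5
      (poincare dodecahedronPolynomial) (linearForm dodecahedronPolynomial pointB) :=
  ⟨⟨isInternal_gradedPiece dodecahedronPolynomial_isHomogeneous,
      fun _ hk => gradedPiece_eq_bot dodecahedronPolynomial_isHomogeneous hk,
      finrank_gradedPiece_dodecahedronPolynomial⟩,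
    ⟨_, isStrongLefschetzElement_pointC⟩, isStrongLefschetzElement_pointC,
    det_hessian_pointB_ne_zero, two_lt_card_pos_eigenvalues, not_satisfiesHodgeRiemann_pointB⟩
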